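/- For an integer $n \ge 1$ let $\mathrm{SL}_n^c = \ker\big(\mathrm{GL}_n \times \mathbb{G}_m \to \mathbb{G}_m,\ (g,t) \mapsto t^{-2}\det g\big)$ be the metalinear group. For a scheme $X$ and $\tau \in \{\mathrm{Zar}, \mathrm{Nis}, \text{ét}\}$ let $\mathrm{Tors}_\tau(X)$ be the groupoid of $\tau$-locally trivial $\mathrm{SL}_n^c$-torsors ($\tau$-sheaf torsors) over $X$, and let $H^1_\tau(X, \mathrm{SL}_n^c)$ be the set of its isomorphism classes. A Nisnevich covering is a family of étale morphisms to $X$ such that every point of $X$ lifts to a point of some member of the family with trivial residue field extension. Then $\mathrm{SL}_n^c$ is special in the sense of Serre: for every scheme $X$, the natural change-of-topology map $$H^1_{\mathrm{Zar}}(X, \mathrm{SL}_n^c) \longrightarrow H^1_{\text{ét}}(X, \mathrm{SL}_n^c)$$ is a bijection. Moreover, the natural maps $H^1_{\mathrm{Zar}}(X, \mathrm{SL}_n^c) \to H^1_{\mathrm{Nis}}(X, \mathrm{SL}_n^c) \to H^1_{\text{ét}}(X, \mathrm{SL}_n^c)$ are both bijections, and the Zariski, Nisnevich and étale classifying spaces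 of $\mathrm{SL}_n^c$ agree, in the sense that the natural functors $\mathrm{Tors}_{\mathrm{Zar}}(X) \to \mathrm{Tors}_{\mathrm{Nis}}(X) \to \mathrm{Tors}_{\text{ét}}(X)$ between the groupoids of sections of $B_{\mathrm{Zar}}\mathrm{SL}_n^c$, $B_{\mathrm{Nis}}\mathrm{SL}_n^c$ and $B_{\text{ét}}\mathrm{SL}_n^c$ over $X$ are equivalences of categories. -/

import Mathlib

open CategoryTheory Opposite

universe u w v₁ u₁

noncomputable section

/-! ### Torsors and nonabelian `H¹` on a site -/

section Torsors

variable {C : Type u₁} [Category.{v₁} C]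

/-- A (left) torsor, for the Grothendieck topology `J`, under a presheaf of groups `G`: a `J`-sheaf
of sets with an action of `G` which is simply transitive wherever there are sections, and which has
sections `J`-locally, over every object of the site. -/
structure SheafTorsor (J : GrothendieckTopology C) (G : Cᵒᵖ ⥤ GrpCat.{w}) where
  /-- the underlying presheaf of sets -/
  carrier : Cᵒᵖ ⥤ Type w
  /-- the action -/
  action : ∀ U : Cᵒᵖ, MulAction (G.obj U) (carrier.obj U)
  map_smul : ∀ {U V : Cᵒᵖ} (f : U ⟶ V) (g : G.obj U) (p : carrier.obj U),
    carrier.map f (g • p) = G.map f g • carrier.map f p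
  isSheaf : Presieve.IsSheaf J carrier
  simply_transitive : ∀ (U : Cᵒᵖ) (p q : carrier.obj U), ∃! g : G.obj U, g • p = q
  locally_nonempty : ∀ U : C, ∃ S ∈ J U, ∀ ⦃V : C⦄ (f : V ⟶ U),
    S f → Nonempty (carrier.obj (op V))

namespace SheafTorsor

variable {J K : GrothendieckTopology C} {G : Cᵒᵖ ⥤ GrpCat.{w}}

instance (P : SheafTorsor J G) (U : Cᵒᵖ) : MulAction (G.obj U) (P.carrier.obj U) := P.action U

/-- Morphisms of torsors are the `G`-equivariant maps. -/
@[ext]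
structure Hom (P Q : SheafTorsor J G) where
  /-- the underlying map of presheaves of sets -/
  toNat : P.carrier ⟶ Q.carrier
  equivariant : ∀ (U : Cᵒᵖ) (g : G.obj U) (p : P.carrier.obj U),
    toNat.app U (g • p) = g • toNat.app U p

/-- The category of `G`-torsors for the topology `J` (it is a groupoid). -/
instance : Category (SheafTorsor J G) where
  Hom P Q := Hom P Q
  id P := ⟨𝟙 _, fun _ _ _ => rfl⟩
  comp f g := ⟨f.toNat ≫ g.toNat, fun U a p => by
    simp [f.equivariant, g.equivariant]⟩
  id_comp _ := Hom.ext (Category.id_comp _)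
  comp_id _ := Hom.ext (Category.comp_id _)
  assoc _ _ _ := Hom.ext (Category.assoc _ _ _)

theorem ext_of_mem (hG : Presieve.IsSheaf K (G ⋙ forget GrpCat)) (P : SheafTorsor J G)
    {U : C} {S : Sieve U} (hS : S ∈ K U) (p q : P.carrier.obj (op U))
    (h : ∀ ⦃V : C⦄ (f : V ⟶ U), S f → P.carrier.map f.op p = P.carrier.map f.op q) : p = q := by
  obtain ⟨g, hg, -⟩ := P.simply_transitive _ p q
  have h1 : g = 1 := by
    refine (hG S hS).isSeparatedFor.ext (t₁ := g) (t₂ := (1 : G.obj (op U))) fun V f hf => ?_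
    have h2 : G.map f.op g • P.carrier.map f.op p = P.carrier.map f.op p := by
      rw [← P.map_smul, hg, h f hf]
    have h3 := (P.simply_transitive _ (P.carrier.map f.op p) (P.carrier.map f.op p)).unique h2
      (one_smul _ _)
    exact h3.trans (map_one (G.map f.op).hom).symm
  rw [← hg, h1, one_smul]

/-- If `G` is a `K`-sheaf, a `G`-torsor for `J` is automatically a `K`-sheaf (so that it agrees
with its `K`-sheafification). -/
theorem isSheaf_of_group (hG : Presieve.IsSheaf K (G ⋙ forget GrpCat))
    (P : SheafTorsor J G) : Presieve.IsSheaf K P.carrier := by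
  intro U S hS x hx
  obtain ⟨R, hR, hne⟩ := P.locally_nonempty U
  have xc : ∀ ⦃V : C⦄ ⦃f f' : V ⟶ U⦄ (_ : f = f') (hf : S f) (hf' : S f'), x f hf = x f' hf' := by
    rintro V f _ rfl _ _
    rfl
  have xm : ∀ ⦃V W : C⦄ (f : V ⟶ U) (g : W ⟶ V) (hf : S f) (hgf : S (g ≫ f)),
      x (g ≫ f) hgf = P.carrier.map g.op (x f hf) := fun V W f g hf _ =>
    (Presieve.compatible_iff_sieveCompatible x).1 hx f g hf
  have key : ∀ ⦃V : C⦄ (f : V ⟶ U), R f → ∃ t : P.carrier.obj (op V),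
      ∀ ⦃W : C⦄ (g : W ⟶ V) (hg : S (g ≫ f)), P.carrier.map g.op t = x (g ≫ f) hg := by
    intro V f hf
    obtain ⟨p⟩ := hne f hf
    choose γ hγ hγu using fun (W : C) (g : W ⟶ V) (hg : S.pullback f g) =>
      P.simply_transitive _ (P.carrier.map g.op p) (x (g ≫ f) hg)
    let y : Presieve.FamilyOfElements (G ⋙ forget GrpCat) (S.pullback f).arrows :=
      fun W g hg => γ W g hg
    have hy : y.Compatible := by
      rw [Presieve.compatible_iff_sieveCompatible]
      intro W W' g h hg
      refine (hγu W' (h ≫ g) _ _ ?_).symm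
      change G.map h.op (γ W g hg) • P.carrier.map (h ≫ g).op p = _
      have e : P.carrier.map (h ≫ g).op p = P.carrier.map h.op (P.carrier.map g.op p) := by simp
      rw [e, ← P.map_smul, hγ]
      exact (xm (g ≫ f) h hg (S.downward_closed hg h)).symm.trans
        (xc (Category.assoc h g f).symm _ _)
    obtain ⟨a, ha, -⟩ := hG _ (K.pullback_stable f hS) y hy
    refine ⟨(show G.obj (op V) from a) • p, fun W g hg => ?_⟩
    rw [P.map_smul]
    have := ha g hg
    change G.map g.op a = γ W g hg at this
    rw [this]
    exact hγ W g hg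
  choose t ht using key
  have htc : Presieve.FamilyOfElements.Compatible (P := P.carrier) (R := R.arrows) t := by
    refine (Presieve.compatible_iff_sieveCompatible (S := R) (P := P.carrier) t).2 ?_
    intro V W f g hf
    refine P.ext_of_mem hG (K.pullback_stable (g ≫ f) hS) _ _ fun Z k hk => ?_
    rw [ht (g ≫ f) _ k hk]
    have hk' : S ((k ≫ g) ≫ f) := by simpa using hk
    have := ht f hf (k ≫ g) hk'
    refine (xc (Category.assoc k g f) hk' hk).symm.trans (this.symm.trans ?_)
    simp
  obtain ⟨s, hs, -⟩ := P.isSheaf R hR t htc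
  refine ⟨s, fun V h hh => ?_, fun s' hs' => ?_⟩
  · refine (P.isSheaf _ (J.pullback_stable h hR)).isSeparatedFor.ext fun W k hk => ?_
    have h1 := hs (k ≫ h) hk
    have h2 := ht (k ≫ h) hk (𝟙 W) (by simpa using S.downward_closed hh k)
    rw [← xm h k hh (S.downward_closed hh k),
      ← xc (Category.id_comp (k ≫ h)) (by simpa using S.downward_closed hh k), ← h2, op_id,
      P.carrier.map_id]
    simpa using h1
  · refine (P.isSheaf R hR).isSeparatedFor.ext fun V f hf => ?_
    rw [hs f hf]
    refine P.ext_of_mem hG (K.pullback_stable f hS) _ _ fun W k hk => ?_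
    rw [ht f hf k hk, ← hs' (k ≫ f) hk]
    simp

/-- Change of topology: if `J ≤ K` and `G` is a `K`-sheaf, a `G`-torsor for `J` is a `G`-torsor
for `K`. The underlying presheaf with action is unchanged, as it is its own `K`-sheafification. -/
def changeTopology (hJK : J ≤ K) (hG : Presieve.IsSheaf K (G ⋙ forget GrpCat)) :
    SheafTorsor J G ⥤ SheafTorsor K G where
  obj P :=
    { carrier := P.carrier
      action := P.action
      map_smul := P.map_smul
      isSheaf := P.isSheaf_of_group hG
      simply_transitive := P.simply_transitive
      locally_nonempty := fun U => by
        obtain ⟨S, hS, h⟩ := P.locally_nonempty U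
        exact ⟨S, hJK U hS, h⟩ }
  map f := ⟨f.toNat, f.equivariant⟩

end SheafTorsor

/-- `H¹_J(C, G)`: the set of isomorphism classes of `G`-torsors for the topology `J`. -/
def TorsorH1 (J : GrothendieckTopology C) (G : Cᵒᵖ ⥤ GrpCat.{w}) :=
  Quotient (isIsomorphicSetoid (SheafTorsor J G))

/-- The change-of-topology map `H¹_J(C, G) → H¹_K(C, G)` for `J ≤ K`. -/
def TorsorH1.changeTopology {J K : GrothendieckTopology C} {G : Cᵒᵖ ⥤ GrpCat.{w}} (hJK : J ≤ K)
    (hG : Presieve.IsSheaf K (G ⋙ forget GrpCat)) : TorsorH1 J G → TorsorH1 K G :=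
  Quotient.map' (SheafTorsor.changeTopology hJK hG).obj
    fun _ _ ⟨e⟩ => ⟨(SheafTorsor.changeTopology hJK hG).mapIso e⟩

end Torsors

/-! ### The metalinear group -/

/-- The homomorphism `GL_n × 𝔾_m → 𝔾_m`, `(g, t) ↦ t⁻² det g`, on `R`-points. -/
def metalinearHom (n : ℕ) (R : Type u) [CommRing R] :
    Matrix.GeneralLinearGroup (Fin n) R × Rˣ →* Rˣ where
  toFun p := p.2 ^ (-2 : ℤ) * Matrix.GeneralLinearGroup.det p.1
  map_one' := by simp
  map_mul' p q := by
    simp only [Prod.fst_mul, Prod.snd_mul, map_mul, mul_zpow]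
    exact mul_mul_mul_comm _ _ _ _

/-- The `R`-points of the metalinear group `SL_n^c = ker (GL_n × 𝔾_m → 𝔾_m)`. -/
def Metalinear (n : ℕ) (R : Type u) [CommRing R] :
    Subgroup (Matrix.GeneralLinearGroup (Fin n) R × Rˣ) :=
  (metalinearHom n R).ker

/-- Functoriality of `SL_n^c(R)` in `R`. -/
def Metalinear.map (n : ℕ) {R S : Type u} [CommRing R] [CommRing S] (f : R →+* S) :
    Metalinear n R →* Metalinear n S :=
  (((Matrix.GeneralLinearGroup.map f).prodMap (Units.map (f : R →* S))).comp
    (Metalinear n R).subtype).codRestrict (Metalinear n S) (by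
    rintro ⟨⟨g, t⟩, h⟩
    have h1 : t ^ (-2 : ℤ) * Matrix.GeneralLinearGroup.det g = 1 := h
    have h2 := congrArg (Units.map (f : R →* S)) h1
    rw [map_mul, map_zpow, map_one, ← Matrix.GeneralLinearGroup.map_det] at h2
    exact h2)

/-- `SL_n^c` as a functor from commutative rings to groups. -/
def metalinearFunctor (n : ℕ) : CommRingCat.{u} ⥤ GrpCat.{u} where
  obj R := GrpCat.of (Metalinear n R)
  map f := GrpCat.ofHom (Metalinear.map n f.hom)
  map_id _ := GrpCat.hom_ext (MonoidHom.ext fun _ =>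
    Subtype.ext (Prod.ext (Units.ext rfl) (Units.ext rfl)))
  map_comp _ _ := GrpCat.hom_ext (MonoidHom.ext fun _ =>
    Subtype.ext (Prod.ext (Units.ext rfl) (Units.ext rfl)))

theorem metalinearFunctor_isSheaf {C : Type u₁} [Category.{v₁} C] {J : GrothendieckTopology C}
    (n : ℕ) (A : Cᵒᵖ ⥤ CommRingCat.{u}) (hA : Presieve.IsSheaf J (A ⋙ forget CommRingCat)) :
    Presieve.IsSheaf J ((A ⋙ metalinearFunctor n) ⋙ forget GrpCat) := by
  intro U S hS x hx
  -- gluing of sections of `A`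
  have sep : ∀ a b : A.obj (op U), (∀ ⦃V : C⦄ (f : V ⟶ U), S f → A.map f.op a = A.map f.op b) →
      a = b := fun a b h => (hA S hS).isSeparatedFor.ext (t₁ := a) (t₂ := b) h
  have glue : ∀ y : (∀ ⦃V : C⦄ (f : V ⟶ U), S f → A.obj (op V)),
      (∀ ⦃V W : C⦄ (f : V ⟶ U) (g : W ⟶ V) (hf : S f),
        y (g ≫ f) (S.downward_closed hf g) = A.map g.op (y f hf)) →
      ∃ a : A.obj (op U), ∀ ⦃V : C⦄ (f : V ⟶ U) (hf : S f), A.map f.op a = y f hf := by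
    intro y hy
    obtain ⟨a, ha, -⟩ := hA S hS y
      ((Presieve.compatible_iff_sieveCompatible (S := S) (P := A ⋙ forget CommRingCat) y).2
        fun V W f g hf => hy f g hf)
    exact ⟨a, ha⟩
  let z : ∀ ⦃V : C⦄ (f : V ⟶ U), S f → Metalinear n (A.obj (op V)) := fun V f hf => x f hf
  have hz : ∀ ⦃V W : C⦄ (f : V ⟶ U) (g : W ⟶ V) (hf : S f),
      z (g ≫ f) (S.downward_closed hf g) = Metalinear.map n (A.map g.op).hom (z f hf) :=
    fun V W f g hf => (Presieve.compatible_iff_sieveCompatible x).1 hx f g hf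
  choose M hM using fun i j => glue (fun V f hf => (z f hf).1.1.1 i j)
    (fun V W f g hf => by rw [hz f g hf]; rfl)
  choose N hN using fun i j => glue (fun V f hf => (z f hf).1.1⁻¹.1 i j)
    (fun V W f g hf => by rw [hz f g hf]; rfl)
  obtain ⟨t, ht⟩ := glue (fun V f hf => (z f hf).1.2.1)
    (fun V W f g hf => by rw [hz f g hf]; rfl)
  obtain ⟨s, hs⟩ := glue (fun V f hf => (z f hf).1.2⁻¹.1)
    (fun V W f g hf => by rw [hz f g hf]; rfl)
  have hM' : ∀ ⦃V : C⦄ (f : V ⟶ U) (hf : S f),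
      (A.map f.op).hom.mapMatrix (Matrix.of M) = (z f hf).1.1.1 :=
    fun V f hf => Matrix.ext fun i j => hM i j f hf
  have hN' : ∀ ⦃V : C⦄ (f : V ⟶ U) (hf : S f),
      (A.map f.op).hom.mapMatrix (Matrix.of N) = (z f hf).1.1⁻¹.1 :=
    fun V f hf => Matrix.ext fun i j => hN i j f hf
  have sepM : ∀ B D : Matrix (Fin n) (Fin n) (A.obj (op U)),
      (∀ ⦃V : C⦄ (f : V ⟶ U), S f →
        (A.map f.op).hom.mapMatrix B = (A.map f.op).hom.mapMatrix D) → B = D :=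
    fun B D h => Matrix.ext fun i j => sep _ _ fun V f hf => congrFun (congrFun (h f hf) i) j
  let g : Matrix.GeneralLinearGroup (Fin n) (A.obj (op U)) :=
    ⟨Matrix.of M, Matrix.of N,
      sepM _ _ fun V f hf => by rw [map_mul, hM' f hf, hN' f hf, map_one, Units.mul_inv],
      sepM _ _ fun V f hf => by rw [map_mul, hM' f hf, hN' f hf, map_one, Units.inv_mul]⟩
  let r : (A.obj (op U))ˣ :=
    ⟨t, s, sep _ _ fun V f hf => by rw [map_mul, ht f hf, hs f hf, map_one, Units.mul_inv],
      sep _ _ fun V f hf => by rw [map_mul, ht f hf, hs f hf, map_one, Units.inv_mul]⟩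
  have hg : ∀ ⦃V : C⦄ (f : V ⟶ U) (hf : S f),
      Matrix.GeneralLinearGroup.map (A.map f.op).hom g = (z f hf).1.1 :=
    fun V f hf => Units.ext (hM' f hf)
  have hr : ∀ ⦃V : C⦄ (f : V ⟶ U) (hf : S f),
      Units.map ((A.map f.op).hom : A.obj (op U) →* A.obj (op V)) r = (z f hf).1.2 :=
    fun V f hf => Units.ext (ht f hf)
  have hk : (g, r) ∈ Metalinear n (A.obj (op U)) := by
    change r ^ (-2 : ℤ) * Matrix.GeneralLinearGroup.det g = 1
    refine Units.ext (sep _ _ fun V f hf => ?_)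
    have h1 : (z f hf).1.2 ^ (-2 : ℤ) * Matrix.GeneralLinearGroup.det (z f hf).1.1 = 1 :=
      (z f hf).2
    rw [← hg f hf, ← hr f hf, Matrix.GeneralLinearGroup.map_det, ← map_zpow, ← map_mul] at h1
    simpa using congrArg Units.val h1
  refine ⟨(⟨(g, r), hk⟩ : Metalinear n (A.obj (op U))), fun V f hf =>
    Subtype.ext (Prod.ext (hg f hf) (hr f hf)), fun b hb => ?_⟩
  change Metalinear n (A.obj (op U)) at b
  have hb' : ∀ ⦃V : C⦄ (f : V ⟶ U) (hf : S f),
      Metalinear.map n (A.map f.op).hom b = z f hf := hb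
  refine Subtype.ext (Prod.ext (Units.ext (sepM _ _ fun V f hf => ?_))
    (Units.ext (sep _ _ fun V f hf => ?_)))
  · rw [hM' f hf, ← hb' f hf]
    rfl
  · exact (congrArg (fun c => c.1.2.1) (hb' f hf)).trans (ht f hf).symm

section Sites
open AlgebraicGeometry

/-- The group scheme `SL_n^c` over `X`, through its functor of points on the category of
`X`-schemes: `T ↦ SL_n^c(Γ(T, 𝒪_T))`. -/
def metalinearGroup (n : ℕ) (X : Scheme.{u}) : (Over X)ᵒᵖ ⥤ GrpCat.{u} :=
  (Over.forget X).op ⋙ Scheme.Γ ⋙ metalinearFunctor n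

/-- Nisnevich coverings: families of étale morphisms such that every point of the base lifts,
with trivial residue field extension, to a member of the family. -/
def nisnevichPrecoverage : Precoverage Scheme.{u} where
  coverings X := {R | (∀ ⦃Y : Scheme.{u}⦄ ⦃f : Y ⟶ X⦄, R f → Etale f) ∧
    ∀ x : X, ∃ (Y : Scheme.{u}) (f : Y ⟶ X) (y : Y), R f ∧ f y = x ∧ IsIso (f.residueFieldMap y)}

/-- The Nisnevich topology on the category of schemes. -/
def nisnevichTopology : GrothendieckTopology Scheme.{u} := nisnevichPrecoverage.toGrothendieck

theorem zariski_le_nisnevich : Scheme.zariskiTopology.{u} ≤ nisnevichTopology := by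
  refine Precoverage.toGrothendieck_mono fun X R hR => ⟨fun Y f hf => ?_, fun x => ?_⟩
  · have : IsOpenImmersion f := hR.2 hf
    infer_instance
  · obtain ⟨_, _, ⟨hf⟩, y, hy⟩ := hR.1 x
    rename_i Y f
    have : IsOpenImmersion f := hR.2 hf
    exact ⟨Y, f, y, hf, hy, inferInstance⟩

theorem nisnevich_le_etale : nisnevichTopology.{u} ≤ Scheme.etaleTopology := by
  refine Precoverage.toGrothendieck_mono fun X R hR => ⟨fun x => ?_, fun Y f hf => hR.1 hf⟩
  obtain ⟨Y, f, y, hf, hy, -⟩ := hR.2 x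
  exact ⟨_, Scheme.forget.map f, Presieve.map_map hf, y, hy⟩

/-- The big Zariski site of `X`-schemes. -/
abbrev zariskiOver (X : Scheme.{u}) : GrothendieckTopology (Over X) := Scheme.zariskiTopology.over X

/-- The big Nisnevich site of `X`-schemes. -/
abbrev nisnevichOver (X : Scheme.{u}) : GrothendieckTopology (Over X) := nisnevichTopology.over X

/-- The big étale site of `X`-schemes. -/
abbrev etaleOver (X : Scheme.{u}) : GrothendieckTopology (Over X) := Scheme.etaleTopology.over X

theorem zariskiOver_le_nisnevichOver (X : Scheme.{u}) : zariskiOver X ≤ nisnevichOver X :=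
  fun _ _ h => zariski_le_nisnevich _ h

theorem nisnevichOver_le_etaleOver (X : Scheme.{u}) : nisnevichOver X ≤ etaleOver X :=
  fun _ _ h => nisnevich_le_etale _ h

theorem zariskiOver_le_etaleOver (X : Scheme.{u}) : zariskiOver X ≤ etaleOver X :=
  (zariskiOver_le_nisnevichOver X).trans (nisnevichOver_le_etaleOver X)

theorem metalinearGroup_isSheaf_etale (n : ℕ) (X : Scheme.{u}) :
    Presieve.IsSheaf (etaleOver X) (metalinearGroup n X ⋙ forget GrpCat) := by
  have hle : Scheme.etaleTopology.{u} ≤ Scheme.fppfTopology :=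
    Scheme.grothendieckTopology_monotone fun _ _ f (_ : Etale f) => ⟨inferInstance, inferInstance⟩
  have hsub : Scheme.etaleTopology.{u}.Subcanonical := .of_le hle
  have h1 : Presieve.IsSheaf Scheme.etaleTopology.{u} (Scheme.Γ ⋙ forget CommRingCat) :=
    Presieve.isSheaf_of_nat_equiv
      (fun T => (AffineSpace.toSpecMvPolyIntEquiv PUnit.{u + 1} (X := T)).trans
        (Equiv.funUnique PUnit _))
      (fun T T' f a => rfl)
      (GrothendieckTopology.Subcanonical.isSheaf_of_isRepresentable
        (yoneda.obj (Spec (.of (MvPolynomial PUnit.{u + 1} (ULift.{u} ℤ))))))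
  have h2 : Presieve.IsSheaf (etaleOver X) ((Over.forget X).op ⋙ Scheme.Γ ⋙ forget CommRingCat) :=
    Functor.op_comp_isSheaf_of_isSheaf_type (Over.forget X) _ h1
  exact metalinearFunctor_isSheaf n ((Over.forget X).op ⋙ Scheme.Γ) h2

theorem metalinearGroup_isSheaf_nisnevich (n : ℕ) (X : Scheme.{u}) :
    Presieve.IsSheaf (nisnevichOver X) (metalinearGroup n X ⋙ forget GrpCat) :=
  Presieve.isSheaf_of_le _ (nisnevichOver_le_etaleOver X) (metalinearGroup_isSheaf_etale n X)

end Sites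

end

/-! A torsor for a coarse topology and a torsor for a finer one are the same kind of presheaf with
action, with the same morphisms, so change of topology is fully faithful. Everything reduces to one
claim: an étale `SL_n^c`-torsor has sections Zariski locally.

Étale locally near a point there is a section over some `Spec B`, with `B` flat over an affine open
`Spec A` of the base. Its two pullbacks to `Spec (B ⊗ B)` differ by a cocycle `γ = (M, t)`. Hilbert
90 holds for `GL_n` and `𝔾_m`: by flatness the vectors `v` with `M (v ⊗ 1) = 1 ⊗ v` span `B^n`
(`span_ker_descentDefect`), so some `n` of them form a basis at a given prime `q`
(`exists_matrix_of_cocycle`). This gives `K` and `σ`, invertible near `q`, that trivialize `M` and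
`t`.

The pair `(K, σ)` may fail `det K = σ²`, but `a = σ⁻² det K` is invariant, because `t⁻² det M = 1`.
Multiplying `K` on the right by `diag(a⁻¹, 1, …, 1)` therefore lands in `SL_n^c` and still
trivializes `γ` (`Metalinear.exists_coboundary`). The section corrected by this element satisfies
the matching condition over `Spec B_d`, hence descends to the open image of `Spec B_d`
(`exists_section_near`). -/

noncomputable section

/-! ### Flat descent and Hilbert 90 for `GL_n` -/

section FlatDescent
open TensorProduct

variable {A B : Type*} [CommRing A] [CommRing B] [Algebra A B] {ι : Type*} [Fintype ι]
  [DecidableEq ι]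

/-- The coface `b ⊗ c ↦ b ⊗ c ⊗ 1`. -/
def coface₁₂ (A B : Type*) [CommRing A] [CommRing B] [Algebra A B] :
    B ⊗[A] B →ₐ[A] B ⊗[A] (B ⊗[A] B) :=
  Algebra.TensorProduct.map (AlgHom.id A B) Algebra.TensorProduct.includeLeft

/-- The coface `b ⊗ c ↦ b ⊗ 1 ⊗ c`. -/
def coface₁₃ (A B : Type*) [CommRing A] [CommRing B] [Algebra A B] :
    B ⊗[A] B →ₐ[A] B ⊗[A] (B ⊗[A] B) :=
  Algebra.TensorProduct.map (AlgHom.id A B) Algebra.TensorProduct.includeRight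

/-- The coface `b ⊗ c ↦ 1 ⊗ b ⊗ c`. -/
def coface₂₃ (A B : Type*) [CommRing A] [CommRing B] [Algebra A B] :
    B ⊗[A] B →ₐ[A] B ⊗[A] (B ⊗[A] B) :=
  Algebra.TensorProduct.includeRight

/-- The defect `v ↦ g (v ⊗ 1) - 1 ⊗ v` of invariance under the descent datum `g`. -/
def descentDefect (g : Matrix ι ι (B ⊗[A] B)) : (ι → B) →ₗ[A] (ι → B ⊗[A] B) where
  toFun v := g.mulVec (fun i => v i ⊗ₜ[A] 1) - fun i => 1 ⊗ₜ[A] v i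
  map_add' v w := by
    ext i
    simp [Matrix.mulVec, dotProduct, TensorProduct.add_tmul, TensorProduct.tmul_add, mul_add,
      Finset.sum_add_distrib]
    ring
  map_smul' a v := by
    ext i
    simp [Matrix.mulVec, dotProduct, ← TensorProduct.smul_tmul', TensorProduct.tmul_smul, smul_sub,
      Finset.smul_sum]

/-- After tensoring with `B` on the left, the defect involves all three cofaces, so the cocycle
condition can make it vanish. -/
theorem piRight_lTensor_descentDefect (g : Matrix ι ι (B ⊗[A] B)) (z : B ⊗[A] (ι → B)) :
    TensorProduct.piRight A A B (fun _ : ι => B ⊗[A] B) ((descentDefect g).lTensor B z) =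
      (g.map (coface₂₃ A B)).mulVec
        (fun i => coface₁₂ A B (TensorProduct.piRight A A B (fun _ : ι => B) z i)) -
      fun i => coface₁₃ A B (TensorProduct.piRight A A B (fun _ : ι => B) z i) := by
  induction z with
  | zero => ext i; simp [Matrix.mulVec, dotProduct]
  | add x y hx hy =>
    rw [map_add, map_add, hx, hy]
    ext i
    simp [Matrix.mulVec, dotProduct, mul_add, Finset.sum_add_distrib]
    ring
  | tmul b v =>
    ext i
    simp [Matrix.mulVec, dotProduct, descentDefect, coface₁₂, coface₁₃, coface₂₃,
      TensorProduct.tmul_sub, TensorProduct.tmul_sum]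

/-- A descent datum restricts to the identity on the diagonal. -/
theorem map_lmul'_eq_one_of_cocycle (g : Matrix ι ι (B ⊗[A] B)) (hu : IsUnit g)
    (hg : g.map (coface₂₃ A B) * g.map (coface₁₂ A B) = g.map (coface₁₃ A B)) :
    g.map (Algebra.TensorProduct.lmul' A (S := B)) = 1 := by
  let m : B ⊗[A] B →ₐ[A] B := Algebra.TensorProduct.lmul' A (S := B)
  -- Multiplying all three factors sends each coface of `g` to the diagonal restriction `e`; the
  -- cocycle condition becomes `e * e = e` with `e` a unit.
  let m₃ : B ⊗[A] (B ⊗[A] B) →ₐ[A] B := m.comp (Algebra.TensorProduct.map (AlgHom.id A B) m)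
  have h₁₂ : m₃.comp (coface₁₂ A B) = m := by ext <;> simp [m₃, m, coface₁₂]
  have h₁₃ : m₃.comp (coface₁₃ A B) = m := by ext <;> simp [m₃, m, coface₁₃]
  have h₂₃ : m₃.comp (coface₂₃ A B) = m := by ext <;> simp [m₃, m, coface₂₃]
  have h := congrArg m₃.mapMatrix hg
  rw [map_mul] at h
  simp only [AlgHom.mapMatrix_apply, Matrix.map_map, ← AlgHom.coe_comp, h₁₂, h₁₃, h₂₃] at h
  exact (hu.map m.mapMatrix).mul_eq_left.1 h

/-- Vectors invariant under a descent datum along a flat algebra span. -/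
theorem span_ker_descentDefect [Module.Flat A B] (g : Matrix ι ι (B ⊗[A] B)) (hu : IsUnit g)
    (hg : g.map (coface₂₃ A B) * g.map (coface₁₂ A B) = g.map (coface₁₃ A B)) :
    Submodule.span B (LinearMap.ker (descentDefect g) : Set (ι → B)) = ⊤ := by
  rw [eq_top_iff]
  rintro v -
  let e := TensorProduct.piRight A A B (fun _ : ι => B)
  let μ : B ⊗[A] (ι → B) →ₗ[A] (ι → B) := 
    TensorProduct.lift (LinearMap.mk₂ A (fun (b : B) (v : ι → B) => b • v) add_smul smul_assoc
      smul_add fun a b v => smul_comm b a v)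
  have hμ : ∀ z i, μ z i = Algebra.TensorProduct.lmul' A (S := B) (e z i) := by
    intro z i
    induction z with
    | zero => simp
    | add x y hx hy => simp [hx, hy]
    | tmul b v => simp [μ, e]
  -- Morally `z` is `v` carried across by `g`. Its defect is `g₂₃ g₁₂ (v ⊗ 1 ⊗ 1) - g₁₃ (v ⊗ 1 ⊗ 1)
  -- = 0`, and multiplication returns `v` because `g` is the identity on the diagonal.
  let z := e.symm (g.mulVec fun i => v i ⊗ₜ[A] 1)
  have hez : e z = g.mulVec fun i => v i ⊗ₜ[A] 1 := e.apply_symm_apply _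
  have hz : (descentDefect g).lTensor B z = 0 := by
    apply (TensorProduct.piRight A A B (fun _ : ι => B ⊗[A] B)).injective
    rw [piRight_lTensor_descentDefect, map_zero, sub_eq_zero]
    change (g.map (coface₂₃ A B)).mulVec (coface₁₂ A B ∘ e z) = coface₁₃ A B ∘ e z
    have h1 := fun (φ : B ⊗[A] B →ₐ[A] B ⊗[A] (B ⊗[A] B)) (w) =>
      funext fun i => RingHom.map_mulVec φ.toRingHom g w i
    have h2 : coface₁₂ A B ∘ e z = (g.map (coface₁₂ A B)).mulVec
        (coface₁₂ A B ∘ fun i => v i ⊗ₜ[A] 1) := by rw [hez]; exact h1 (coface₁₂ A B) _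
    have h3 : coface₁₃ A B ∘ e z = (g.map (coface₁₃ A B)).mulVec
        (coface₁₃ A B ∘ fun i => v i ⊗ₜ[A] 1) := by rw [hez]; exact h1 (coface₁₃ A B) _
    rw [h2, h3, Matrix.mulVec_mulVec, hg]
    congr 1
  have hz' : z ∈ LinearMap.ker ((descentDefect g).lTensor B) := hz
  -- Flatness: the kernel of `B ⊗ defect` is the image of `B ⊗ ker`, so `z` is a sum of tensors `b ⊗
  -- x` with `x` invariant.
  rw [LinearMap.exact_iff.1 (Module.Flat.lTensor_exact B
    (LinearMap.exact_subtype_ker_map (descentDefect g)))] at hz'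
  obtain ⟨y, hy⟩ := hz'
  have hv : v = μ z := by
    ext i
    rw [hμ, hez]
    have := RingHom.map_mulVec (Algebra.TensorProduct.lmul' A (S := B)).toRingHom g
      (fun i => v i ⊗ₜ[A] 1) i
    refine Eq.trans ?_ this.symm
    have h4 := map_lmul'_eq_one_of_cocycle g hu hg
    change _ = (g.map (Algebra.TensorProduct.lmul' A (S := B))).mulVec _ i
    rw [h4, Matrix.one_mulVec]
    simp
  rw [hv, ← hy]
  clear hy
  induction y with
  | zero => simp
  | add x y hx hy => simpa using add_mem hx hy
  | tmul b x =>
    simpa [μ] using Submodule.smul_mem _ b (Submodule.subset_span x.2)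

/-- Hilbert's theorem 90 for `GL_n` along a flat algebra, near a prime. -/
theorem exists_matrix_of_cocycle [Module.Flat A B] (g : Matrix ι ι (B ⊗[A] B)) (hu : IsUnit g)
    (hg : g.map (coface₂₃ A B) * g.map (coface₁₂ A B) = g.map (coface₁₃ A B))
    (q : Ideal B) [q.IsPrime] :
    ∃ k : Matrix ι ι B, k.det ∉ q ∧
      g * k.map (Algebra.TensorProduct.includeLeft : B →ₐ[A] B ⊗[A] B) =
        k.map (Algebra.TensorProduct.includeRight : B →ₐ[A] B ⊗[A] B) := by
  let κ := q.ResidueField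
  let c : (ι → B) →ₗ[B] (ι → κ) := (Algebra.linearMap B κ).compLeft ι
  let s : Set (ι → κ) := c '' (LinearMap.ker (descentDefect g) : Set (ι → B))
  have hs : Submodule.span κ s = ⊤ := by
    have h1 : ∀ v : ι → B, c v ∈ Submodule.span κ s := fun v => by
      have : v ∈ Submodule.span B (LinearMap.ker (descentDefect g) : Set (ι → B)) := by
        rw [span_ker_descentDefect g hu hg]; trivial
      induction this using Submodule.span_induction with
      | mem x h => exact Submodule.subset_span ⟨x, h, rfl⟩
      | zero => simp
      | add x y _ _ hx hy => simpa using add_mem hx hy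
      | smul b x _ hx =>
        rw [map_smul, ← algebraMap_smul κ b (c x)]
        exact Submodule.smul_mem _ _ hx
    rw [eq_top_iff, ← (Pi.basisFun κ ι).span_eq, Submodule.span_le]
    rintro _ ⟨i, rfl⟩
    have h2 := h1 (Pi.single i 1)
    have h3 : c (Pi.single i 1) = Pi.basisFun κ ι i := by
      ext j
      simp [c, Pi.single_apply, apply_ite (algebraMap B κ)]
    rwa [h3] at h2
  -- The images of invariant vectors span `κ(q)^ι`, so a basis can be extracted from them; its
  -- invariant lifts are the columns of `k`.
  obtain ⟨f, hf, -, hli⟩ := Submodule.exists_fun_fin_finrank_span_eq κ s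
  have hcard : Module.finrank κ (Submodule.span κ s) = Fintype.card ι := by
    rw [hs, finrank_top, Module.finrank_fintype_fun_eq_card]
  let σ : ι ≃ Fin (Module.finrank κ (Submodule.span κ s)) :=
    (Fintype.equivFin ι).trans (finCongr hcard.symm)
  choose m hm hmf using hf
  refine ⟨Matrix.of fun i j => m (σ j) i, fun hq => ?_, ?_⟩
  · have h2 : IsUnit (Matrix.of fun i j => f (σ j) i) :=
      Matrix.linearIndependent_cols_iff_isUnit.1 (hli.comp σ σ.injective)
    rw [Matrix.isUnit_iff_isUnit_det] at h2
    refine h2.ne_zero ?_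
    rw [← Ideal.algebraMap_residueField_eq_zero (I := q), RingHom.map_det] at hq
    convert hq
    ext i j
    simp [← hmf, c, κ]
  · ext i j
    have := congrFun (hm (σ j)) i
    exact sub_eq_zero.1 this
end FlatDescent

/-! ### Metalinear cocycles are locally coboundaries -/

section Metalinear
open TensorProduct

variable {R S : Type u} [CommRing R] [CommRing S]

theorem Metalinear.map_map {T : Type u} [CommRing T] (n : ℕ) (f : R →+* S) (g : S →+* T)
    (x : Metalinear n R) :
    Metalinear.map n g (Metalinear.map n f x) = Metalinear.map n (g.comp f) x :=
  Subtype.ext (Prod.ext (Units.ext rfl) (Units.ext rfl))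

/-- The diagonal matrix `diag(a, 1, …, 1)`. -/
def diagonalFirst (n : ℕ) [NeZero n] (a : Rˣ) : Matrix.GeneralLinearGroup (Fin n) R where
  val := Matrix.diagonal (Pi.mulSingle 0 (a : R))
  inv := Matrix.diagonal (Pi.mulSingle 0 ((a⁻¹ : Rˣ) : R))
  val_inv := by
    rw [Matrix.diagonal_mul_diagonal']
    change Matrix.diagonal (Pi.mulSingle (M := fun _ : Fin n => R) 0 (a : R) *
      Pi.mulSingle (M := fun _ : Fin n => R) 0 ((a⁻¹ : Rˣ) : R)) = 1
    rw [← Pi.mulSingle_mul, Units.mul_inv, Pi.mulSingle_one]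
    exact Matrix.diagonal_one
  inv_val := by
    rw [Matrix.diagonal_mul_diagonal']
    change Matrix.diagonal (Pi.mulSingle (M := fun _ : Fin n => R) 0 ((a⁻¹ : Rˣ) : R) *
      Pi.mulSingle (M := fun _ : Fin n => R) 0 (a : R)) = 1
    rw [← Pi.mulSingle_mul, Units.inv_mul, Pi.mulSingle_one]
    exact Matrix.diagonal_one

theorem det_diagonalFirst (n : ℕ) [NeZero n] (a : Rˣ) :
    Matrix.GeneralLinearGroup.det (diagonalFirst n a) = a :=
  Units.ext <| by
    simp [diagonalFirst, Matrix.det_diagonal, Pi.mulSingle_apply, Finset.prod_ite_eq']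

theorem map_diagonalFirst (n : ℕ) [NeZero n] (f : R →+* S) (a : Rˣ) :
    Matrix.GeneralLinearGroup.map f (diagonalFirst n a) =
      diagonalFirst n (Units.map (f : R →* S) a) :=
  Units.ext <| Matrix.ext fun i j => by
    by_cases h : i = j
    · subst h
      by_cases h0 : i = 0 <;> simp [diagonalFirst, h0]
    · simp [diagonalFirst, h]

/-- A cocycle in the metalinear group along a flat algebra is a coboundary near any prime. -/
theorem Metalinear.exists_coboundary {A B : Type u} [CommRing A] [CommRing B] [Algebra A B]
    [Module.Flat A B] (n : ℕ) (hn : 1 ≤ n) (γ : Metalinear n (B ⊗[A] B))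
    (hγ : Metalinear.map n (coface₂₃ A B).toRingHom γ *
      Metalinear.map n (coface₁₂ A B).toRingHom γ = Metalinear.map n (coface₁₃ A B).toRingHom γ)
    (q : Ideal B) [q.IsPrime] :
    ∃ d : B, d ∉ q ∧ ∃ h : Metalinear n (Localization.Away d),
      ∀ (R : Type u) [CommRing R] (α β : Localization.Away d →+* R) (c : B ⊗[A] B →+* R),
        c.comp (Algebra.TensorProduct.includeLeft : B →ₐ[A] B ⊗[A] B).toRingHom =
          α.comp (algebraMap B _) →
        c.comp (Algebra.TensorProduct.includeRight : B →ₐ[A] B ⊗[A] B).toRingHom =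
          β.comp (algebraMap B _) →
        Metalinear.map n c γ * Metalinear.map n α h = Metalinear.map n β h := by
  have : NeZero n := ⟨by omega⟩
  let M := γ.1.1
  let t := γ.1.2
  obtain ⟨k, hkq, hk⟩ := exists_matrix_of_cocycle M.1 M.isUnit
    (congrArg (fun x => x.1.1.1) hγ) q
  -- The unit `t` is treated as a `1 × 1` matrix.
  obtain ⟨s', hsq, hs⟩ := exists_matrix_of_cocycle
    (Matrix.of fun _ _ : Unit => (t : B ⊗[A] B))
    (by rw [Matrix.isUnit_iff_isUnit_det, Matrix.det_unique]; exact t.isUnit)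
    (Matrix.ext fun i j => by
      have h : coface₂₃ A B t * coface₁₂ A B t = coface₁₃ A B t :=
        congrArg (fun x => x.1.2.1) hγ
      simpa [Matrix.mul_apply] using h) q
  let s := s' () ()
  replace hsq : s ∉ q := by rwa [Matrix.det_unique] at hsq
  replace hs : (t : B ⊗[A] B) * s ⊗ₜ[A] 1 = 1 ⊗ₜ[A] s := by
    simpa [Matrix.mul_apply] using congrFun (congrFun hs ()) ()
  refine ⟨k.det * s, fun h => (Ideal.IsPrime.mem_or_mem ‹_› h).elim hkq hsq, ?_⟩
  let L := Localization.Away (k.det * s)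
  have hu : IsUnit (algebraMap B L (k.det * s)) := IsLocalization.Away.algebraMap_isUnit _
  rw [map_mul, IsUnit.mul_iff] at hu
  let K : Matrix.GeneralLinearGroup (Fin n) L :=
    ((Matrix.isUnit_iff_isUnit_det ((algebraMap B L).mapMatrix k)).2
      (by rw [← RingHom.map_det]; exact hu.1)).unit
  let σ : Lˣ := hu.2.unit
  -- The failure of `(K, σ)` to lie in `SL_n^c`. A diagonal matrix of determinant `a⁻¹` corrects it;
  -- no root of `a` is needed.
  let a : Lˣ := σ ^ (-2 : ℤ) * Matrix.GeneralLinearGroup.det K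
  have hmem : (K * diagonalFirst n a⁻¹, σ) ∈ Metalinear n L := by
    change σ ^ (-2 : ℤ) * Matrix.GeneralLinearGroup.det (K * diagonalFirst n a⁻¹) = 1
    rw [map_mul, det_diagonalFirst, ← mul_assoc]
    exact mul_inv_cancel a
  refine ⟨⟨_, hmem⟩, fun R _ α β c hα hβ => ?_⟩
  have e1 : Matrix.GeneralLinearGroup.map c M * Matrix.GeneralLinearGroup.map α K =
      Matrix.GeneralLinearGroup.map β K := by
    have h1 := congrArg c.mapMatrix hk
    rw [map_mul] at h1
    have hl : c.mapMatrix (k.map (Algebra.TensorProduct.includeLeft : B →ₐ[A] B ⊗[A] B)) =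
        α.mapMatrix ((algebraMap B L).mapMatrix k) :=
      Matrix.ext fun i j => RingHom.congr_fun hα (k i j)
    have hr : c.mapMatrix (k.map (Algebra.TensorProduct.includeRight : B →ₐ[A] B ⊗[A] B)) =
        β.mapMatrix ((algebraMap B L).mapMatrix k) :=
      Matrix.ext fun i j => RingHom.congr_fun hβ (k i j)
    rw [hl, hr] at h1
    exact Units.ext h1
  have e2 : Units.map (c : _ →* R) t * Units.map (α : L →* R) σ = Units.map (β : L →* R) σ := by
    have h1 := congrArg c hs
    rw [map_mul] at h1
    have hl : c (s ⊗ₜ[A] 1) = α (algebraMap B L s) := RingHom.congr_fun hα s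
    have hr : c (1 ⊗ₜ[A] s) = β (algebraMap B L s) := RingHom.congr_fun hβ s
    rw [hl, hr] at h1
    exact Units.ext h1
  have e3 : Units.map (c : _ →* R) t ^ (-2 : ℤ) *
      Matrix.GeneralLinearGroup.det (Matrix.GeneralLinearGroup.map c M) = 1 :=
    (Metalinear.map n c γ).2
  -- By `e1` and `e2`, passing from `α` to `β` multiplies `a` by `t⁻² det M`, which is `1`.
  have e4 : Units.map (α : L →* R) a = Units.map (β : L →* R) a := by
    simp only [a, map_mul, map_zpow]
    rw [← e2, ← Matrix.GeneralLinearGroup.map_det, ← Matrix.GeneralLinearGroup.map_det, ← e1,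
      map_mul, mul_zpow, mul_mul_mul_comm, e3, one_mul]
  refine Subtype.ext (Prod.ext ?_ e2)
  change Matrix.GeneralLinearGroup.map c M *
    Matrix.GeneralLinearGroup.map α (K * diagonalFirst n a⁻¹) =
    Matrix.GeneralLinearGroup.map β (K * diagonalFirst n a⁻¹)
  rw [map_mul, map_mul, ← mul_assoc, e1, map_diagonalFirst, map_diagonalFirst, map_inv, map_inv, e4]

end Metalinear

/-! ### Comparing torsors for two topologies -/

section Comparison

variable {C : Type u₁} [Category.{v₁} C] {J K : GrothendieckTopology C} {G : Cᵒᵖ ⥤ GrpCat.{w}}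

namespace SheafTorsor

theorem changeTopology_full (hJK : J ≤ K) (hG : Presieve.IsSheaf K (G ⋙ forget GrpCat)) :
    (changeTopology hJK hG).Full :=
  ⟨fun f => ⟨⟨f.toNat, f.equivariant⟩, rfl⟩⟩

theorem changeTopology_faithful (hJK : J ≤ K) (hG : Presieve.IsSheaf K (G ⋙ forget GrpCat)) :
    (changeTopology hJK hG).Faithful :=
  ⟨fun h => by
    have h' := congrArg Hom.toNat h
    exact Hom.ext h'⟩

/-- Change of topology is an equivalence as soon as torsors for the finer topology have sections
locally for the coarser one. -/
theorem changeTopology_isEquivalence (hJK : J ≤ K)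
    (hG : Presieve.IsSheaf K (G ⋙ forget GrpCat))
    (h : ∀ (P : SheafTorsor K G) (U : C), ∃ S ∈ J U, ∀ ⦃V : C⦄ (f : V ⟶ U),
      S f → Nonempty (P.carrier.obj (op V))) :
    (changeTopology hJK hG).IsEquivalence :=
  { full := changeTopology_full hJK hG
    faithful := changeTopology_faithful hJK hG
    -- The sheaf condition passes down to the coarser topology; local sections are what `h`
    -- supplies.
    essSurj := ⟨fun P =>
      ⟨{  carrier := P.carrier
          action := P.action
          map_smul := P.map_smul
          isSheaf := Presieve.isSheaf_of_le _ hJK P.isSheaf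
          simply_transitive := P.simply_transitive
          locally_nonempty := h P }, ⟨Iso.refl _⟩⟩⟩ }

end SheafTorsor

theorem TorsorH1.changeTopology_bijective (hJK : J ≤ K)
    (hG : Presieve.IsSheaf K (G ⋙ forget GrpCat))
    (h : (SheafTorsor.changeTopology hJK hG).IsEquivalence) :
    Function.Bijective (TorsorH1.changeTopology hJK hG) := by
  constructor
  · rintro ⟨P⟩ ⟨Q⟩ hPQ
    obtain ⟨e⟩ := Quotient.exact hPQ
    exact Quotient.sound ⟨(SheafTorsor.changeTopology hJK hG).preimageIso e⟩
  · rintro ⟨Q⟩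
    exact ⟨Quotient.mk _ ((SheafTorsor.changeTopology hJK hG).objPreimage Q),
      Quotient.sound ⟨(SheafTorsor.changeTopology hJK hG).objObjPreimageIso Q⟩⟩

end Comparison

/-! ### Sections over affine schemes and their cocycles -/

section Special
open AlgebraicGeometry TensorProduct

variable {X : Scheme.{u}}

/-- The ring homomorphism `R → Γ(Z, 𝒪_Z)` corresponding to a morphism `Z ⟶ Spec R`. -/
def toSpecRingHom {R : CommRingCat.{u}} {Z : Scheme.{u}} (a : Z ⟶ Spec R) : R →+* Γ(Z, ⊤) :=
  ((Scheme.ΓSpecIso R).inv ≫ a.appTop).hom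

theorem toSpecRingHom_comp_SpecMap {R S : CommRingCat.{u}} {Z : Scheme.{u}} (a : Z ⟶ Spec S)
    (φ : R ⟶ S) : toSpecRingHom (a ≫ Spec.map φ) = (toSpecRingHom a).comp φ.hom := by
  rw [toSpecRingHom, toSpecRingHom, Scheme.Hom.comp_appTop, ← Scheme.ΓSpecIso_inv_naturality_assoc,
    CommRingCat.hom_comp]

/-- The section of the metalinear group over `Spec R` given by an `R`-point. -/
def metalinearSection (n : ℕ) {R : CommRingCat.{u}} (r : Spec R ⟶ X) :
    Metalinear n R →* (metalinearGroup n X).obj (op (Over.mk r)) :=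
  Metalinear.map n (Scheme.ΓSpecIso R).inv.hom

theorem metalinearSection_bijective (n : ℕ) {R : CommRingCat.{u}} (r : Spec R ⟶ X) :
    Function.Bijective (metalinearSection n r) := by
  have h1 : (Scheme.ΓSpecIso R).hom.hom.comp (Scheme.ΓSpecIso R).inv.hom = RingHom.id R := by
    rw [← CommRingCat.hom_comp, Iso.inv_hom_id, CommRingCat.hom_id]
  have h2 : (Scheme.ΓSpecIso R).inv.hom.comp (Scheme.ΓSpecIso R).hom.hom = RingHom.id _ := by
    rw [← CommRingCat.hom_comp, Iso.hom_inv_id, CommRingCat.hom_id]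
  have h3 : ∀ (S : Type u) [CommRing S] (x : Metalinear n S),
      Metalinear.map n (RingHom.id S) x = x := fun S _ x =>
    Subtype.ext (Prod.ext (Units.ext rfl) (Units.ext rfl))
  refine Function.bijective_iff_has_inverse.2
    ⟨Metalinear.map n (Scheme.ΓSpecIso R).hom.hom, fun x => ?_, fun x => ?_⟩
  · exact (Metalinear.map_map n _ _ x).trans (by rw [h1, h3])
  · exact (Metalinear.map_map n _ _ x).trans ((congrArg (fun f => Metalinear.map n f x) h2).trans (h3 _ x))

/-- Here `Z` need not be affine: pulling back to it only involves a ring homomorphism into its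
global sections, which is why coboundaries are tested in arbitrary rings. -/
theorem map_metalinearSection (n : ℕ) {R : CommRingCat.{u}} (r : Spec R ⟶ X) {Z : Over X}
    (a : Z ⟶ Over.mk r) (x : Metalinear n R) :
    (metalinearGroup n X).map a.op (metalinearSection n r x) =
      (Metalinear.map n (toSpecRingHom (a.left : Z.left ⟶ Spec R)) x :
        Metalinear n Γ(Z.left, ⊤)) :=
  Metalinear.map_map n _ _ x

theorem map_metalinearSection_SpecMap (n : ℕ) {R S : CommRingCat.{u}} (r : Spec R ⟶ X)
    (s : Spec S ⟶ X) (φ : R ⟶ S) (a : Over.mk s ⟶ Over.mk r) (ha : a.left = Spec.map φ)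
    (x : Metalinear n R) :
    (metalinearGroup n X).map a.op (metalinearSection n r x) =
      metalinearSection n s (Metalinear.map n φ.hom x) := by
  rw [map_metalinearSection, ha, toSpecRingHom, ← Scheme.ΓSpecIso_inv_naturality]
  exact (Metalinear.map_map n _ _ x).symm

namespace SheafTorsor

variable {C : Type u₁} [Category.{v₁} C] {J : GrothendieckTopology C} {G : Cᵒᵖ ⥤ GrpCat.{w}}

theorem smul_right_injective (P : SheafTorsor J G) {U : Cᵒᵖ} (p : P.carrier.obj U)
    {g h : G.obj U} (e : g • p = h • p) : g = h :=
  (P.simply_transitive U p (h • p)).unique e rfl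

theorem map_map (P : SheafTorsor J G) {U V W : C} (f : U ⟶ V) (g : V ⟶ W)
    (p : P.carrier.obj (op W)) :
    P.carrier.map f.op (P.carrier.map g.op p) = P.carrier.map (f ≫ g).op p := by
  simp

/-- The transition functions of a section satisfy the cocycle condition. -/
theorem cocycle (P : SheafTorsor J G) {V E F : C} {p₁ p₂ : E ⟶ V} {d₁₂ d₁₃ d₂₃ : F ⟶ E}
    (h₁ : d₁₂ ≫ p₁ = d₁₃ ≫ p₁) (h₂ : d₁₂ ≫ p₂ = d₂₃ ≫ p₁) (h₃ : d₂₃ ≫ p₂ = d₁₃ ≫ p₂)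
    (p : P.carrier.obj (op V)) (g : G.obj (op E))
    (hg : g • P.carrier.map p₁.op p = P.carrier.map p₂.op p) :
    G.map d₂₃.op g * G.map d₁₂.op g = G.map d₁₃.op g := by
  have key : ∀ d : F ⟶ E, G.map d.op g • P.carrier.map (d ≫ p₁).op p =
      P.carrier.map (d ≫ p₂).op p := fun d => by
    rw [← map_map, ← map_map, ← hg, P.map_smul]
  refine P.smul_right_injective (P.carrier.map (d₁₂ ≫ p₁).op p) ?_
  rw [mul_smul, key, h₂, key, h₃, h₁, key]

end SheafTorsor

/-- A metalinear torsor with a section over an affine scheme, flat over an affine open subscheme of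
the base, has matching sections near any point. -/
theorem exists_matching_section (n : ℕ) (hn : 1 ≤ n) {J : GrothendieckTopology (Over X)}
    (P : SheafTorsor J (metalinearGroup n X)) {T : Scheme.{u}} (t : T ⟶ X)
    {A B : Type u} [CommRing A] [CommRing B] [Algebra A B] [Module.Flat A B]
    (i : Spec (.of A) ⟶ T) [Mono i]
    (p : P.carrier.obj
      (op (Over.mk ((Spec.map (CommRingCat.ofHom (algebraMap A B)) ≫ i) ≫ t))))
    (q : Ideal B) [q.IsPrime] :
    ∃ d : B, d ∉ q ∧
      let f := Spec.map (CommRingCat.ofHom (algebraMap B (Localization.Away d))) ≫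
        Spec.map (CommRingCat.ofHom (algebraMap A B)) ≫ i
      ∃ y : P.carrier.obj (op (Over.mk (f ≫ t))),
        ∀ ⦃Z : Over X⦄ (a b : Z ⟶ Over.mk (f ≫ t)), a.left ≫ f = b.left ≫ f →
          P.carrier.map a.op y = P.carrier.map b.op y := by
  let φ := CommRingCat.ofHom (algebraMap A B)
  let iL : CommRingCat.of B ⟶ CommRingCat.of (B ⊗[A] B) :=
    CommRingCat.ofHom (Algebra.TensorProduct.includeLeft : B →ₐ[A] B ⊗[A] B).toRingHom
  let iR : CommRingCat.of B ⟶ CommRingCat.of (B ⊗[A] B) :=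
    CommRingCat.ofHom (Algebra.TensorProduct.includeRight : B →ₐ[A] B ⊗[A] B).toRingHom
  let c₁₂ := CommRingCat.ofHom (coface₁₂ A B).toRingHom
  let c₁₃ := CommRingCat.ofHom (coface₁₃ A B).toRingHom
  let c₂₃ := CommRingCat.ofHom (coface₂₃ A B).toRingHom
  have hLR : φ ≫ iL = φ ≫ iR := by
    ext a
    exact ((Algebra.TensorProduct.includeLeft : B →ₐ[A] B ⊗[A] B).commutes a).trans
      ((Algebra.TensorProduct.includeRight : B →ₐ[A] B ⊗[A] B).commutes a).symm
  have h₁ : iL ≫ c₁₂ = iL ≫ c₁₃ := by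
    ext b; simp [iL, c₁₂, c₁₃, coface₁₂, coface₁₃]
  have h₂ : iR ≫ c₁₂ = iL ≫ c₂₃ := by
    ext b; simp [iL, iR, c₁₂, c₂₃, coface₁₂, coface₂₃]
  have h₃ : iR ≫ c₂₃ = iR ≫ c₁₃ := by
    ext b; simp [iR, c₁₃, c₂₃, coface₁₃, coface₂₃]
  let v := (Spec.map φ ≫ i) ≫ t
  let e : Spec (.of (B ⊗[A] B)) ⟶ X := Spec.map iL ≫ v
  let w : Spec (.of (B ⊗[A] (B ⊗[A] B))) ⟶ X := Spec.map c₁₂ ≫ e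
  let p₁ : Over.mk e ⟶ Over.mk v := Over.homMk (Spec.map iL)
  let p₂ : Over.mk e ⟶ Over.mk v := Over.homMk (Spec.map iR) (by
    simp only [Over.mk_left, Over.mk_hom, e, v, Category.assoc, ← Spec.map_comp_assoc, hLR])
  have hw : w = Spec.map (φ ≫ iL ≫ c₁₂) ≫ i ≫ t := by simp [w, e, v]
  let d₁₂ : Over.mk w ⟶ Over.mk e := Over.homMk (Spec.map c₁₂)
  let d₁₃ : Over.mk w ⟶ Over.mk e := Over.homMk (Spec.map c₁₃) (by
    change Spec.map c₁₃ ≫ e = w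
    rw [hw, h₁]
    simp [e, v])
  let d₂₃ : Over.mk w ⟶ Over.mk e := Over.homMk (Spec.map c₂₃) (by
    change Spec.map c₂₃ ≫ e = w
    rw [hw, ← Category.assoc φ, hLR, Category.assoc, h₂]
    simp [e, v])
  obtain ⟨g, hg, -⟩ := P.simply_transitive _ (P.carrier.map p₁.op p) (P.carrier.map p₂.op p)
  have hc := P.cocycle (d₁₂ := d₁₂) (d₁₃ := d₁₃) (d₂₃ := d₂₃)
    (Over.OverMorphism.ext (by
      change Spec.map c₁₂ ≫ Spec.map iL = Spec.map c₁₃ ≫ Spec.map iL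
      rw [← Spec.map_comp, ← Spec.map_comp, h₁]))
    (Over.OverMorphism.ext (by
      change Spec.map c₁₂ ≫ Spec.map iR = Spec.map c₂₃ ≫ Spec.map iL
      rw [← Spec.map_comp, ← Spec.map_comp, h₂]))
    (Over.OverMorphism.ext (by
      change Spec.map c₂₃ ≫ Spec.map iR = Spec.map c₁₃ ≫ Spec.map iR
      rw [← Spec.map_comp, ← Spec.map_comp, h₃])) p g hg
  obtain ⟨γ, rfl⟩ := (metalinearSection_bijective n e).2 g
  rw [map_metalinearSection_SpecMap n e w c₁₂ d₁₂ rfl,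
    map_metalinearSection_SpecMap n e w c₁₃ d₁₃ rfl,
    map_metalinearSection_SpecMap n e w c₂₃ d₂₃ rfl, ← map_mul] at hc
  obtain ⟨d, hd, h, hh⟩ := Metalinear.exists_coboundary n hn γ
    ((metalinearSection_bijective n w).1 hc) q
  refine ⟨d, hd, ?_⟩
  intro f
  let loc := CommRingCat.ofHom (algebraMap B (Localization.Away d))
  let l : Over.mk (f ≫ t) ⟶ Over.mk v := Over.homMk (Spec.map loc) (by
    simp [f, v, loc, φ])
  -- With `γ • p₁ = p₂` and `γ * a^*h = b^*h`, the elements `(a^*h)⁻¹ • p₁` and `(b^*h)⁻¹ • p₂`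
  -- coincide.
  refine ⟨(metalinearSection n (f ≫ t) h)⁻¹ • P.carrier.map l.op p, fun Z a b hab => ?_⟩
  have hsq : (a ≫ l).left ≫ Spec.map φ = (b ≫ l).left ≫ Spec.map φ := by
    -- Since `i` is mono, agreement in `T` is agreement over `Spec A`, so the pair `(a, b)` factors
    -- through `Spec (B ⊗ B)`.
    rw [← cancel_mono i]
    simpa [l, f] using hab
  have hpb := (isPullback_SpecMap_of_isPushout _ _ _ _
    (CommRingCat.isPushout_tensorProduct A B B))
  let z : Z.left ⟶ Spec (.of (B ⊗[A] B)) := hpb.lift (a ≫ l).left (b ≫ l).left hsq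
  have hz₁ : z ≫ Spec.map iL = (a ≫ l).left := hpb.lift_fst _ _ hsq
  have hz₂ : z ≫ Spec.map iR = (b ≫ l).left := hpb.lift_snd _ _ hsq
  let m : Z ⟶ Over.mk e := Over.homMk z (by
    rw [← Over.w (a ≫ l), ← hz₁]
    simp [e])
  have hm₁ : m ≫ p₁ = a ≫ l := Over.OverMorphism.ext hz₁
  have hm₂ : m ≫ p₂ = b ≫ l := Over.OverMorphism.ext hz₂
  have hcob := hh _ (toSpecRingHom (a.left : Z.left ⟶ Spec (.of (Localization.Away d))))
    (toSpecRingHom (b.left : Z.left ⟶ Spec (.of (Localization.Away d)))) (toSpecRingHom z)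
    (by
      have := congrArg toSpecRingHom hz₁
      rw [toSpecRingHom_comp_SpecMap] at this
      exact this.trans (toSpecRingHom_comp_SpecMap a.left loc))
    (by
      have := congrArg toSpecRingHom hz₂
      rw [toSpecRingHom_comp_SpecMap] at this
      exact this.trans (toSpecRingHom_comp_SpecMap b.left loc))
  have hcob' : (metalinearGroup n X).map m.op (metalinearSection n e γ) *
      (metalinearGroup n X).map a.op (metalinearSection n (f ≫ t) h) =
      (metalinearGroup n X).map b.op (metalinearSection n (f ≫ t) h) := by
    rw [map_metalinearSection, map_metalinearSection, map_metalinearSection]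
    exact hcob
  have hgm := congrArg (P.carrier.map m.op) hg
  rw [P.map_smul, P.map_map, P.map_map, hm₁, hm₂] at hgm
  rw [P.map_smul, P.map_smul, P.map_map, P.map_map, ← hgm, map_inv, map_inv, ← hcob', mul_inv_rev,
    mul_smul, inv_smul_smul]

end Special

/-! ### From étale sections to Zariski sections -/

section Special
open AlgebraicGeometry TensorProduct

variable {X : Scheme.{u}}

/-- A morphism of schemes which is étale and surjective generates an étale covering sieve. -/
theorem generate_singleton_mem_etaleOver {V W : Over X} (f : V ⟶ W) [Etale f.left]
    [Surjective f.left] : Sieve.generate (Presieve.singleton f) ∈ etaleOver X W := by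
  refine Scheme.mem_grothendieckTopology_iff.2
    ⟨Scheme.Cover.mkOfCovers PUnit (fun _ => V.left) (fun _ => f.left)
      (fun x => ⟨⟨⟩, f.left.surjective x⟩) (fun _ => inferInstance), ?_⟩
  rintro _ _ ⟨⟩
  refine (Sieve.overEquiv_iff _ f.left).2 ⟨V, Over.homMk (𝟙 V.left) ?_, f, ⟨⟩, ?_⟩
  · simp
  · ext1
    simp

/-- Étale torsors under the metalinear group have sections near every point. -/
theorem exists_section_near (n : ℕ) (hn : 1 ≤ n)
    (P : SheafTorsor (etaleOver X) (metalinearGroup n X)) (T : Over X) (x : T.left) :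
    ∃ W : T.left.Opens, x ∈ W ∧ Nonempty (P.carrier.obj (op (Over.mk (W.ι ≫ T.hom)))) := by
  obtain ⟨S, hS, hne⟩ := P.locally_nonempty T
  obtain ⟨𝒰, h𝒰⟩ := Scheme.mem_grothendieckTopology_iff.1 hS
  obtain ⟨h₀, h₁⟩ := (Scheme.presieve₀_mem_precoverage_iff (P := @Etale)
    𝒰.toPreZeroHypercover).1 𝒰.mem₀
  obtain ⟨j, y, hy⟩ := h₀ x
  have hf : Etale (𝒰.f j) := h₁ j
  have hSf := (Sieve.overEquiv_iff S (𝒰.f j)).1 (h𝒰 _ _ ⟨j⟩)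
  obtain ⟨p₀⟩ := hne _ hSf
  generalize 𝒰.f j = f at *
  generalize 𝒰.X j = Y at *
  obtain ⟨_, ⟨U, hU, rfl⟩, hxU, -⟩ :=
    T.left.isBasis_affineOpens.exists_subset_of_mem_open (Set.mem_univ x) isOpen_univ
  obtain ⟨_, ⟨V, hV, rfl⟩, hyV, hVU⟩ :=
    Y.isBasis_affineOpens.exists_subset_of_mem_open (show y ∈ f ⁻¹ᵁ U by simpa [hy] using hxU)
      (f ⁻¹ᵁ U).2
  replace hU : IsAffineOpen U := hU
  replace hV : IsAffineOpen V := hV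
  let φ := f.appLE U V hVU
  algebraize [φ.hom]
  have hflat : Module.Flat Γ(T.left, U) Γ(Y, V) := f.flat_appLE hU hV hVU
  have hsq : Spec.map φ ≫ hU.fromSpec = hV.fromSpec ≫ f := hU.SpecMap_appLE_fromSpec f hV hVU
  let p := P.carrier.map (Over.homMk hV.fromSpec (by
    change hV.fromSpec ≫ f ≫ T.hom = (Spec.map φ ≫ hU.fromSpec) ≫ T.hom
    rw [hsq, Category.assoc]) :
    Over.mk ((Spec.map φ ≫ hU.fromSpec) ≫ T.hom) ⟶ Over.mk (f ≫ T.hom)).op p₀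
  obtain ⟨q, hq⟩ : y ∈ Set.range hV.fromSpec := by rw [hV.range_fromSpec]; exact hyV
  have : (PrimeSpectrum.asIdeal q).IsPrime := PrimeSpectrum.isPrime q
  let i : Spec (.of Γ(T.left, U)) ⟶ T.left := hU.fromSpec
  have : Mono i := inferInstanceAs (Mono hU.fromSpec)
  obtain ⟨d, hd, z, hz⟩ := exists_matching_section n hn P T.hom i p
    (PrimeSpectrum.asIdeal q)
  let loc := CommRingCat.ofHom (algebraMap Γ(Y, V) (Localization.Away d))
  let F := Spec.map loc ≫ Spec.map φ ≫ hU.fromSpec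
  have : IsOpenImmersion (Spec.map loc) := inferInstanceAs (IsOpenImmersion
    (Spec.map (CommRingCat.ofHom (algebraMap Γ(Y, V) (Localization.Away d)))))
  have hF : F = Spec.map loc ≫ hV.fromSpec ≫ f := by rw [← hsq]
  have hFe : Etale F := by rw [hF]; infer_instance
  -- An étale map is open, so its image is an open neighbourhood of `x` that `Spec B_d` covers
  -- étale-locally.
  let W : T.left.Opens := ⟨Set.range F, F.isOpenMap.isOpen_range⟩
  have hxW : x ∈ W := by
    obtain ⟨q', hq'⟩ : q ∈ Set.range (Spec.map loc) := by
      change q ∈ Set.range (PrimeSpectrum.comap (algebraMap Γ(Y, V) (Localization.Away d)))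
      rw [PrimeSpectrum.localization_away_comap_range _ d]
      exact hd
    refine ⟨q', ?_⟩
    rw [hF]
    simp [hq', hq, hy]
  let F' : Spec (.of (Localization.Away d)) ⟶ W := IsOpenImmersion.lift W.ι F (by simp [W])
  have hF' : F' ≫ W.ι = F := IsOpenImmersion.lift_fac _ _ _
  have : Etale F' := by
    have : Etale (F' ≫ W.ι) := by rwa [hF']
    exact Etale.of_comp F' W.ι
  have : Surjective F' := ⟨fun w => by
    obtain ⟨a, ha⟩ := w.2
    refine ⟨a, W.ι.isOpenEmbedding.injective ?_⟩
    rw [← Scheme.Hom.comp_apply, hF', ha]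
    rfl⟩
  let k : Over.mk (F ≫ T.hom) ⟶ Over.mk (W.ι ≫ T.hom) := Over.homMk F' (by
    change F' ≫ W.ι ≫ T.hom = F ≫ T.hom
    rw [← hF', Category.assoc])
  have : Etale k.left := ‹Etale F'›
  have : Surjective k.left := ‹Surjective F'›
  have hs := P.isSheaf _ (generate_singleton_mem_etaleOver k)
  rw [← Presieve.isSheafFor_iff_generate, Presieve.isSheafFor_singleton] at hs
  -- The matching property of `z` is exactly the compatibility needed to descend it along `F'`,
  -- after composing with the inclusion of `W`.
  obtain ⟨s, -, -⟩ := hs z fun {Z} a b hab => hz a b (by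
    have h := congrArg (fun m => m.left ≫ W.ι) hab
    change (a.left ≫ F') ≫ W.ι = (b.left ≫ F') ≫ W.ι at h
    have hc : ∀ m : Z.left ⟶ Spec (.of (Localization.Away d)), (m ≫ F') ≫ W.ι = m ≫ F :=
      fun m => by rw [Category.assoc, hF']
    exact (hc a.left).symm.trans (h.trans (hc b.left)))
  exact ⟨W, hxW, ⟨s⟩⟩

/-- Étale torsors under the metalinear group have sections Zariski locally. -/
theorem exists_zariskiOver_section (n : ℕ) (hn : 1 ≤ n)
    (P : SheafTorsor (etaleOver X) (metalinearGroup n X)) (T : Over X) :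
    ∃ S ∈ zariskiOver X T, ∀ ⦃V : Over X⦄ (f : V ⟶ T),
      S f → Nonempty (P.carrier.obj (op V)) := by
  -- The largest possible sieve: all objects over which `P` has a section.
  let S : Sieve T :=
    { arrows := fun V _ => Nonempty (P.carrier.obj (op V))
      downward_closed := fun ⟨p⟩ g => ⟨P.carrier.map g.op p⟩ }
  refine ⟨S, ?_, fun V f h => h⟩
  choose W hxW hW using exists_section_near n hn P T
  refine Scheme.mem_grothendieckTopology_iff.2 ⟨Scheme.Cover.mkOfCovers T.left (fun x => (W x).toScheme) (fun x => (W x).ι)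
    (fun x => ⟨x, ⟨x, hxW x⟩, rfl⟩) (fun x => inferInstance), ?_⟩
  rintro _ _ ⟨x⟩
  exact (Sieve.overEquiv_iff S (W x).ι).2 (hW x)

end Special

end

theorem mainTheorem7 (n : ℕ) (hn : 1 ≤ n) (X : AlgebraicGeometry.Scheme.{u}) :
    Function.Bijective
      (TorsorH1.changeTopology (zariskiOver_le_etaleOver X) (metalinearGroup_isSheaf_etale n X) :
        TorsorH1 (zariskiOver X) (metalinearGroup n X) →
          TorsorH1 (etaleOver X) (metalinearGroup n X)) ∧
    Function.Bijective
      (TorsorH1.changeTopology (zariskiOver_le_nisnevichOver X)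
        (metalinearGroup_isSheaf_nisnevich n X) :
        TorsorH1 (zariskiOver X) (metalinearGroup n X) →
          TorsorH1 (nisnevichOver X) (metalinearGroup n X)) ∧
    Function.Bijective
      (TorsorH1.changeTopology (nisnevichOver_le_etaleOver X) (metalinearGroup_isSheaf_etale n X) :
        TorsorH1 (nisnevichOver X) (metalinearGroup n X) →
          TorsorH1 (etaleOver X) (metalinearGroup n X)) ∧
    (SheafTorsor.changeTopology (zariskiOver_le_nisnevichOver X)
      (metalinearGroup_isSheaf_nisnevich n X) :
      SheafTorsor (zariskiOver X) (metalinearGroup n X) ⥤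
        SheafTorsor (nisnevichOver X) (metalinearGroup n X)).IsEquivalence ∧
    (SheafTorsor.changeTopology (nisnevichOver_le_etaleOver X)
      (metalinearGroup_isSheaf_etale n X) :
      SheafTorsor (nisnevichOver X) (metalinearGroup n X) ⥤
        SheafTorsor (etaleOver X) (metalinearGroup n X)).IsEquivalence := by
  have hZ := exists_zariskiOver_section (X := X) n hn
  have hZE := SheafTorsor.changeTopology_isEquivalence (zariskiOver_le_etaleOver X)
    (metalinearGroup_isSheaf_etale n X) hZ
  -- A Nisnevich torsor is also an étale torsor with the same sections, so `hZ` applies to it.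
  have hZN := SheafTorsor.changeTopology_isEquivalence (zariskiOver_le_nisnevichOver X)
    (metalinearGroup_isSheaf_nisnevich n X) fun P => hZ
      ((SheafTorsor.changeTopology (nisnevichOver_le_etaleOver X)
        (metalinearGroup_isSheaf_etale n X)).obj P)
  have hNE := SheafTorsor.changeTopology_isEquivalence (nisnevichOver_le_etaleOver X)
    (metalinearGroup_isSheaf_etale n X) fun P T => by
      obtain ⟨S, hS, h⟩ := hZ P T
      exact ⟨S, zariskiOver_le_nisnevichOver X _ hS, h⟩
  exact ⟨TorsorH1.changeTopology_bijective _ _ hZE, TorsorH1.changeTopology_bijective _ _ hZN,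
    TorsorH1.changeTopology_bijective _ _ hNE, hZN, hNE⟩
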